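/- Let $A\subseteq R$ be an extension of commutative rings such that $R$ is finitely generated as an $A$-module. Assume that $A$ is noetherian and normal (that is, $A_{\mathfrak q}$ is an integrally closed domain for every prime ideal $\mathfrak q$ of $A$), that $R$ is equidimensional (that is, there is an integer $d\ge 0$ such that $\dim(R/\mathfrak q)=d$ for every minimal prime $\mathfrak q$ of $R$, where $\dim$ denotes Krull dimension), and that $R$ has finite projective dimension as an $A$-module. If $$2\operatorname{depth} R_{\mathfrak p}\ \ge\ \dim R_{\mathfrak p}\qquad\text{for every prime ideal } \mathfrak p \text{ of } R,$$ then $\operatorname{Tor}_i^A(R,R)=0$ for all $i\ge 1$. -/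

import Mathlib

open CategoryTheory

universe u

/-- A commutative ring is normal if its localizations at all prime ideals are integrally closed
domains. -/
structure IsNormalRing (A : Type*) [CommRing A] : Prop where
  isDomain : ∀ (p : Ideal A) [p.IsPrime], IsDomain (Localization.AtPrime p)
  isIntegrallyClosed : ∀ (p : Ideal A) [p.IsPrime], IsIntegrallyClosed (Localization.AtPrime p)

/-- A (noetherian) ring is equidimensional if the Krull dimension of `R ⧸ q` is the same finite
number for all minimal primes `q` of `R`. -/
def IsEquidimensional (R : Type*) [CommRing R] : Prop :=
  ∃ d : ℕ, ∀ q ∈ minimalPrimes R, ringKrullDim (R ⧸ q) = d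

/-- The depth of a (noetherian) local ring: the supremum of the lengths of the regular sequences
contained in its maximal ideal. -/
noncomputable def localDepth (R : Type*) [CommRing R] [IsLocalRing R] : ℕ∞ :=
  sSup {n | ∃ rs : List R, (∀ r ∈ rs, r ∈ IsLocalRing.maximalIdeal R) ∧
    RingTheory.Sequence.IsRegular R rs ∧ n = (rs.length : ℕ∞)}

/-! Fix a prime `m` of `A` of height `h`. Going down holds for `A ⊆ R`: equidimensionality makes
minimal primes of `R` contract to minimal primes of `A`, and modulo these the base is an integrally
closed domain (`IsNormalRing.hasGoingDown`). Hence every prime `p` over `m` has height at least `h`,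
and the hypothesis gives depth `R_p ≥ ⌈h/2⌉`. Depth over `A_m` is controlled by the primes above `m`
(`DepthGE.of_forall_comap_eq`), so `R_m` has depth at least `⌈h/2⌉` over `A_m`. The
Auslander–Buchsbaum inequality `pd + depth ≤ dim` (`hasProjectiveDimensionLT_of_isWeaklyRegular`)
then yields `pd R_m ≤ ⌊h/2⌋ ≤ depth R_m`.

It remains to see that `N` and `M` are Tor-independent when `pd M_m ≤ depth N_m` at every `m`
(`isZero_Tor_and_depthGE_tensorProduct`). For `0 → K → P → M → 0` with `P` free, induction on `pd M`
handles `K` and bounds the depth of `N ⊗ K` from below. An associated prime of `Tor₁(N, M) ⊆ N ⊗ K`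
is excluded where `N ⊗ K` has positive depth, and also where `M` is locally free; these two cases
cover all primes. -/

/-! ### Dimension shifting for left derived functors and Tor -/

section TorShift

open Limits

variable {C : Type*} [Category* C] [Abelian C]

lemma CategoryTheory.ShortComplex.Exact.comp_mono {X Y Z W : C} {f : X ⟶ Y} {g : Y ⟶ Z}
    {w : f ≫ g = 0} (h : (ShortComplex.mk f g w).Exact) (i : Z ⟶ W) [Mono i]
    {g' : Y ⟶ W} (hg' : g' = g ≫ i) (w' : f ≫ g' = 0) : (ShortComplex.mk f g' w').Exact := by
  subst hg'
  let φ : ShortComplex.mk f g w ⟶ ShortComplex.mk f (g ≫ i) w' :=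
    { τ₁ := 𝟙 _, τ₂ := 𝟙 _, τ₃ := i }
  have : Epi φ.τ₁ := inferInstanceAs (Epi (𝟙 X))
  have : IsIso φ.τ₂ := inferInstanceAs (IsIso (𝟙 Y))
  have : Mono φ.τ₃ := ‹Mono i›
  exact (ShortComplex.exact_iff_of_epi_of_isIso_of_mono φ).1 h

lemma CategoryTheory.ShortComplex.Exact.epi_comp {X Y Z W : C} {f : X ⟶ Y} {g : Y ⟶ Z}
    {w : f ≫ g = 0} (h : (ShortComplex.mk f g w).Exact) (p : W ⟶ X) [Epi p]
    {f' : W ⟶ Y} (hf' : f' = p ≫ f) {g' : Y ⟶ Z} (hg' : g' = g) (w' : f' ≫ g' = 0) :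
    (ShortComplex.mk f' g' w').Exact := by
  subst hf' hg'
  let φ : ShortComplex.mk (p ≫ f) g' w' ⟶ ShortComplex.mk f g' w :=
    { τ₁ := p, τ₂ := 𝟙 _, τ₃ := 𝟙 _ }
  have : Epi φ.τ₁ := ‹Epi p›
  have : IsIso φ.τ₂ := inferInstanceAs (IsIso (𝟙 Y))
  have : Mono φ.τ₃ := inferInstanceAs (Mono (𝟙 Z))
  exact (ShortComplex.exact_iff_of_epi_of_isIso_of_mono φ).2 h

namespace CategoryTheory.ProjectiveResolution

/-- The augmentation of a projective resolution. -/
noncomputable def aug {Z : C} (Q : ProjectiveResolution Z) : Q.complex.X 0 ⟶ Z := Q.π.f 0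

instance {Z : C} (Q : ProjectiveResolution Z) : Epi Q.aug :=
  inferInstanceAs (Epi (Q.π.f 0))

lemma d_comp_aug {Z : C} (Q : ProjectiveResolution Z) : Q.complex.d 1 0 ≫ Q.aug = 0 :=
  Q.complex_d_comp_π_f_zero

lemma exact_aug {Z : C} (Q : ProjectiveResolution Z) :
    (ShortComplex.mk _ _ Q.d_comp_aug).Exact := Q.exact₀

lemma d_comp_aug_comp {Z W : C} (Q : ProjectiveResolution Z) (f : Z ⟶ W) :
    Q.complex.d 1 0 ≫ Q.aug ≫ f = 0 := by
  rw [← Category.assoc, Q.d_comp_aug, zero_comp]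

lemma aug_comp_zero (S : ShortComplex C) (Q : ProjectiveResolution S.X₁) :
    (Q.aug ≫ S.f) ≫ S.g = 0 := by
  rw [Category.assoc, S.zero, comp_zero]

/-- Splicing a projective resolution of the kernel of an epimorphism from a projective object. -/
noncomputable def splice {S : ShortComplex C} (hS : S.ShortExact)
    (hP : Projective S.X₂) (Q : ProjectiveResolution S.X₁) : ProjectiveResolution S.X₃ where
  complex := Q.complex.augment (Q.aug ≫ S.f) (Q.d_comp_aug_comp S.f)
  projective n := by
    cases n with
    | zero => exact hP
    | succ n => exact Q.projective n
  π := (ChainComplex.toSingle₀Equiv _ _).symm ⟨S.g, by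
    rw [ChainComplex.augment_d_one_zero]
    exact Q.aug_comp_zero S⟩
  quasiIso := ⟨fun n => by
    have := hS.mono_f
    have := hS.epi_g
    cases n with
    | zero =>
      rw [ChainComplex.quasiIsoAt₀_iff, ShortComplex.quasiIso_iff_of_zeros']
      · dsimp
        have e := ChainComplex.toSingle₀Equiv_symm_apply_f_zero
          (C := Q.complex.augment (Q.aug ≫ S.f) (Q.d_comp_aug_comp S.f)) S.g
          (Q.aug_comp_zero S)
        have e' : Epi (((Q.complex.augment (Q.aug ≫ S.f)
          (Q.d_comp_aug_comp S.f)).toSingle₀Equiv S.X₃).symm ⟨S.g, Q.aug_comp_zero S⟩ |>.f 0) := by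
          rw [e]; exact this
        exact ⟨hS.exact.epi_comp Q.aug rfl e _, e'⟩
      all_goals rfl
    | succ n =>
      rw [quasiIsoAt_iff_exactAt' _ _ (ChainComplex.exactAt_succ_single_obj _ _),
        HomologicalComplex.exactAt_iff' _ (n + 1 + 1) (n + 1) n (by simp) (by simp)]
      cases n with
      | zero => exact Q.exact_aug.comp_mono S.f rfl (Q.d_comp_aug_comp S.f)
      | succ n => exact Q.exact_succ n⟩

end CategoryTheory.ProjectiveResolution

variable {D : Type*} [Category* D] [Abelian D] [HasProjectiveResolutions C] (F : C ⥤ D)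
  [F.Additive]

lemma CategoryTheory.ProjectiveResolution.isZero_leftDerived_iff {X : C}
    (P : ProjectiveResolution X) (n : ℕ) :
    IsZero ((F.leftDerived (n + 1)).obj X) ↔
      ((ShortComplex.mk _ _ (P.complex.d_comp_d (n + 2) (n + 1) n)).map F).Exact := by
  rw [(P.isoLeftDerivedObj F (n + 1)).isZero_iff]
  erw [← HomologicalComplex.exactAt_iff_isZero_homology]
  rw [HomologicalComplex.exactAt_iff' _ (n + 1 + 1) (n + 1) n (by simp) (by simp)]
  rfl

/-- The spliced resolution of `S.X₃` is the resolution of `S.X₁` moved up one degree, so both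
vanishing statements are exactness of the same three-term complex. -/
lemma CategoryTheory.Functor.isZero_leftDerived_add_two {S : ShortComplex C} (hS : S.ShortExact)
    (hP : Projective S.X₂) (n : ℕ) (h : IsZero ((F.leftDerived (n + 1)).obj S.X₁)) :
    IsZero ((F.leftDerived (n + 2)).obj S.X₃) := by
  let Q := projectiveResolution S.X₁
  rw [(ProjectiveResolution.splice hS hP Q).isZero_leftDerived_iff F]
  exact (Q.isZero_leftDerived_iff F n).1 h

/-- Right exactness keeps the end of the resolution of `S.X₁` exact after `F`; composing with the
monomorphism `F.map S.f` does not change the kernel. -/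
lemma CategoryTheory.Functor.isZero_leftDerived_one [PreservesFiniteColimits F]
    {S : ShortComplex C} (hS : S.ShortExact) (hP : Projective S.X₂) (h : Mono (F.map S.f)) :
    IsZero ((F.leftDerived 1).obj S.X₃) := by
  let Q := projectiveResolution S.X₁
  rw [(ProjectiveResolution.splice hS hP Q).isZero_leftDerived_iff F 0]
  exact (Q.exact_aug.map_of_epi_of_preservesCokernel F
    (inferInstanceAs (Epi Q.aug)) inferInstance).comp_mono (F.map S.f)
      (F.map_comp Q.aug S.f)
      (by rw [← F.map_comp, Q.d_comp_aug_comp, F.map_zero])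

end TorShift

open MonoidalCategory in
lemma ModuleCat.isZero_Tor_of_shortExact {A : Type u} [CommRing A] (N : ModuleCat.{u} A)
    {S : ShortComplex (ModuleCat.{u} A)} (hS : S.ShortExact) (hP : Projective S.X₂)
    (hinj : Function.Injective (LinearMap.lTensor N S.f.hom))
    (hK : ∀ i : ℕ, 1 ≤ i → Limits.IsZero (((Tor (ModuleCat.{u} A) i).obj N).obj S.X₁)) :
    ∀ i : ℕ, 1 ≤ i → Limits.IsZero (((Tor (ModuleCat.{u} A) i).obj N).obj S.X₃) := by
  intro i hi
  have : Limits.PreservesFiniteColimits ((tensoringLeft (ModuleCat.{u} A)).obj N) :=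
    inferInstanceAs (Limits.PreservesFiniteColimits (tensorLeft N))
  match i, hi with
  | 1, _ =>
    refine Functor.isZero_leftDerived_one _ hS hP ?_
    exact (ModuleCat.mono_iff_injective _).2 hinj
  | n + 2, _ => exact Functor.isZero_leftDerived_add_two _ hS hP n (hK (n + 1) (by omega))

/-! ### Projective dimension through syzygies -/

section Helpers

variable {A : Type u} [CommRing A] {K P M : Type u} [AddCommGroup K] [Module A K]
  [AddCommGroup P] [Module A P] [AddCommGroup M] [Module A M]

/-- The short complex of modules attached to an exact pair of linear maps. -/
abbrev Function.Exact.shortComplex {f : K →ₗ[A] P} {g : P →ₗ[A] M} (h : Function.Exact f g) :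
    ShortComplex (ModuleCat.{u} A) :=
  ModuleCat.shortComplexOfCompEqZero f g h.linearMap_comp_eq_zero

lemma Function.Exact.shortExact {f : K →ₗ[A] P} {g : P →ₗ[A] M} (h : Function.Exact f g)
    (hf : Function.Injective f) (hg : Function.Surjective g) : h.shortComplex.ShortExact where
  exact := ModuleCat.shortComplex_exact _ h
  mono_f := (ModuleCat.mono_iff_injective _).2 hf
  epi_g := (ModuleCat.epi_iff_surjective _).2 hg

lemma Function.Exact.hasProjectiveDimensionLT_iff [Module.Projective A P]
    {f : K →ₗ[A] P} {g : P →ₗ[A] M} (h : Function.Exact f g)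
    (hf : Function.Injective f) (hg : Function.Surjective g) (n : ℕ) :
    HasProjectiveDimensionLT (ModuleCat.of A M) (n + 2) ↔
      HasProjectiveDimensionLT (ModuleCat.of A K) (n + 1) :=
  (h.shortExact hf hg).hasProjectiveDimensionLT_X₃_iff n
    (inferInstanceAs (Projective (ModuleCat.of A P)))

lemma ModuleCat.hasProjectiveDimensionLT_one_iff :
    HasProjectiveDimensionLT (ModuleCat.of A M) 1 ↔ Module.Projective A M := by
  rw [← projective_iff_hasProjectiveDimensionLT_one, ← IsProjective.iff_projective]

end Helpers

/-! ### Projective dimension over a noetherian local ring: bounds by dimension and depth -/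

section

variable {A : Type u} [CommRing A] [IsLocalRing A]

open IsLocalRing

lemma IsLocalRing.one_tmul_eq_zero_iff {M : Type*} [AddCommGroup M] [Module A M] (y : M) :
    (1 : ResidueField A) ⊗ₜ[A] y = 0 ↔ y ∈ maximalIdeal A • (⊤ : Submodule A M) := by
  rw [← LinearMap.ker_tensorProductMk]
  rfl

/-- Over a noetherian local ring of depth zero, modules of finite projective dimension are free. -/
lemma Module.free_of_hasProjectiveDimensionLT_of_smul_eq_zero [IsNoetherianRing A] {z : A}
    (hz : z ≠ 0) (hm : ∀ a ∈ maximalIdeal A, a * z = 0) (n : ℕ) (N : Type u) [AddCommGroup N]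
    [Module A N] [Module.Finite A N] (hN : HasProjectiveDimensionLT (ModuleCat.of A N) (n + 1)) :
    Module.Free A N := by
  induction n generalizing N with
  | zero =>
    have := ModuleCat.hasProjectiveDimensionLT_one_iff.1 hN
    exact Module.free_of_flat_of_isLocalRing
  | succ n ih =>
    obtain ⟨r, f, hf⟩ := Module.Finite.exists_fin' A N
    have hex := f.exact_subtype_ker_map
    have : Module.Free A (LinearMap.ker f) := ih _
      ((hex.hasProjectiveDimensionLT_iff (Submodule.subtype_injective _) hf n).1 hN)
    refine Module.free_of_lTensor_residueField_injective _ f hf hex ?_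
    rw [injective_iff_map_eq_zero]
    intro t ht
    obtain ⟨k, rfl⟩ := TensorProduct.mk_surjective A (LinearMap.ker f) (ResidueField A)
      Ideal.Quotient.mk_surjective t
    rw [TensorProduct.mk_apply, LinearMap.lTensor_tmul, one_tmul_eq_zero_iff] at ht
    rw [TensorProduct.mk_apply, one_tmul_eq_zero_iff]
    -- The image of `k` lies in `𝔪P`, which `z` kills. As `z ≠ 0`, no coordinate of `k` in a basis
    -- of the free kernel can then be a unit.
    have hzk : z • k = 0 := by
      apply Subtype.ext
      change z • (LinearMap.ker f).subtype k = 0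
      generalize (LinearMap.ker f).subtype k = v at ht ⊢
      refine Submodule.smul_induction_on (p := fun v => z • v = 0) ht (fun a ha y _ => ?_) (fun x y hx hy => ?_)
      · rw [smul_smul, mul_comm, hm a ha, zero_smul]
      · rw [smul_add, hx, hy, add_zero]
    let b := Module.Free.chooseBasis A (LinearMap.ker f)
    rw [← b.sum_repr k]
    refine Submodule.sum_mem _ fun i _ => Submodule.smul_mem_smul ?_ trivial
    by_contra hu
    have h0 : z * b.repr k i = 0 := by
      have := congr(b.repr $hzk i)
      simpa using this
    have hu' : IsUnit (b.repr k i) := by simpa using hu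
    exact hz (hu'.mul_left_eq_zero.1 h0)

lemma IsLocalRing.nontrivial_quotient_span_singleton_of_mem {x : A} (hx : x ∈ maximalIdeal A) :
    Nontrivial (A ⧸ Ideal.span {x}) :=
  Ideal.Quotient.nontrivial_iff.2 (((Ideal.span_singleton_le_iff_mem _).2 hx).trans_lt
    (maximalIdeal.isMaximal A).ne_top.lt_top).ne

open Pointwise in
/-- For a module-regular and ring-regular element `x` of the maximal ideal, the projective
dimension of `M` over `A` is that of `M / xM` over `A / x`. -/
lemma hasProjectiveDimensionLT_quotSMulTop_iff [IsNoetherianRing A] {x : A}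
    (hx : x ∈ maximalIdeal A) (hA : IsSMulRegular A x) (n : ℕ) (M : Type u) [AddCommGroup M]
    [Module A M] [Module.Finite A M] (hM : IsSMulRegular M x) :
    HasProjectiveDimensionLT (ModuleCat.of (A ⧸ Ideal.span {x}) (QuotSMulTop x M)) (n + 1) ↔
      HasProjectiveDimensionLT (ModuleCat.of A M) (n + 1) := by
  have hjac : x ∈ (⊥ : Ideal A).jacobson := by
    rwa [jacobson_eq_maximalIdeal ⊥ bot_ne_top]
  have := nontrivial_quotient_span_singleton_of_mem hx
  have : IsLocalRing (A ⧸ Ideal.span {x}) :=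
    IsLocalRing.of_surjective' (Ideal.Quotient.mk _) Ideal.Quotient.mk_surjective
  induction n generalizing M with
  | zero =>
    rw [zero_add, ModuleCat.hasProjectiveDimensionLT_one_iff,
      ModuleCat.hasProjectiveDimensionLT_one_iff]
    have : Module.Finite (A ⧸ Ideal.span {x}) (QuotSMulTop x M) :=
      Module.Finite.of_restrictScalars_finite A _ _
    have : Module.FinitePresentation A M := Module.finitePresentation_of_finite A M
    have h := Module.free_quotSMulTop_iff_free A M hjac hM
    constructor
    · intro _
      have := h.1 Module.free_of_flat_of_isLocalRing
      infer_instance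
    · intro _
      have := h.2 Module.free_of_flat_of_isLocalRing
      infer_instance
  | succ n ih =>
    obtain ⟨r, f, hf⟩ := Module.Finite.exists_fin' A M
    have hex := f.exact_subtype_ker_map
    have hinj := Submodule.subtype_injective (LinearMap.ker f)
    rw [hex.hasProjectiveDimensionLT_iff hinj hf n]
    have hP : IsSMulRegular (Fin r → A) x := IsSMulRegular.pi fun _ => hA
    refine Iff.trans ?_ (ih (LinearMap.ker f) (hP.submodule _ _))
    have hs : Function.Surjective (algebraMap A (A ⧸ Ideal.span {x})) :=
      Ideal.Quotient.mk_surjective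
    let i' := (QuotSMulTop.map x (LinearMap.ker f).subtype).extendScalarsOfSurjective hs
    let f' := (QuotSMulTop.map x f).extendScalarsOfSurjective hs
    have hex' : Function.Exact i' f' := QuotSMulTop.map_exact x hex hf
    refine hex'.hasProjectiveDimensionLT_iff ?_ (QuotSMulTop.map_surjective x hf) n
    change Function.Injective (QuotSMulTop.map x (LinearMap.ker f).subtype)
    -- This is `Tor₁(A/x, M) = 0`: if `k = x • y` in the free module, then `x • f y = 0`, so `f y =
    -- 0` by regularity on `M`.
    rw [injective_iff_map_eq_zero]
    intro t ht
    obtain ⟨k, rfl⟩ := Submodule.Quotient.mk_surjective _ t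
    rw [QuotSMulTop.map_apply_mk, Submodule.Quotient.mk_eq_zero,
      Submodule.mem_smul_pointwise_iff_exists] at ht
    obtain ⟨y, -, hy⟩ := ht
    rw [Submodule.Quotient.mk_eq_zero, Submodule.mem_smul_pointwise_iff_exists]
    refine ⟨⟨y, ?_⟩, trivial, Subtype.ext hy⟩
    rw [LinearMap.mem_ker]
    refine hM.right_eq_zero_of_smul ?_
    rw [← map_smul, hy]
    exact k.2

/-- The dichotomy depth positive or zero, read off from whether `Hom(κ, M)` vanishes. -/
lemma IsLocalRing.exists_isSMulRegular_or_exists_smul_eq_zero [IsNoetherianRing A]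
    (M : Type*) [AddCommGroup M] [Module A M] [Module.Finite A M] :
    (∃ x ∈ maximalIdeal A, IsSMulRegular M x) ∨
      ∃ z : M, z ≠ 0 ∧ ∀ a ∈ maximalIdeal A, a • z = 0 := by
  by_cases h : Subsingleton (ResidueField A →ₗ[A] M)
  · obtain ⟨x, hx, hreg⟩ := IsSMulRegular.subsingleton_linearMap_iff.1 h
    refine Or.inl ⟨x, ?_, hreg⟩
    have := Ideal.annihilator_quotient (I := maximalIdeal A)
    exact this ▸ hx
  · rw [not_subsingleton_iff_nontrivial] at h
    obtain ⟨f, hf⟩ := exists_ne (0 : ResidueField A →ₗ[A] M)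
    refine Or.inr ⟨f 1, fun h1 => hf ?_, fun a ha => ?_⟩
    · ext y
      obtain ⟨a, rfl⟩ := Ideal.Quotient.mk_surjective y
      change f (algebraMap A (ResidueField A) a) = 0
      rw [Algebra.algebraMap_eq_smul_one, map_smul, h1, smul_zero]
    · rw [← map_smul, ← Algebra.algebraMap_eq_smul_one, ResidueField.algebraMap_eq,
        (residue_eq_zero_iff a).2 ha, map_zero]

end

open IsLocalRing in
/-- Over a noetherian local ring, finite projective dimension is at most the Krull dimension. -/
lemma hasProjectiveDimensionLT_of_ringKrullDim_le (h : ℕ) (A : Type u) [CommRing A]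
    [IsLocalRing A] [IsNoetherianRing A] (hA : ringKrullDim A ≤ h) (N : Type u) [AddCommGroup N]
    [Module A N] [Module.Finite A N] {n : ℕ}
    (hN : HasProjectiveDimensionLT (ModuleCat.of A N) n) :
    HasProjectiveDimensionLT (ModuleCat.of A N) (h + 1) := by
  replace hN : HasProjectiveDimensionLT (ModuleCat.of A N) (n + 1) :=
    hasProjectiveDimensionLT_of_ge _ n _ n.le_succ
  induction h generalizing A N n with
  | zero =>
    rcases exists_isSMulRegular_or_exists_smul_eq_zero (A := A) A with ⟨x, hx, hreg⟩ | ⟨z, hz, hm⟩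
    · have := nontrivial_quotient_span_singleton_of_mem hx
      have hdim := ringKrullDim_quotient_span_singleton_succ_eq_ringKrullDim_of_mem_jacobson hreg
        (by rwa [IsLocalRing.ringJacobson_eq_maximalIdeal])
      rw [← hdim, Nat.cast_zero, ENat.WithBot.add_one_le_zero_iff] at hA
      have h0 := ringKrullDim_nonneg_of_nontrivial (R := A ⧸ Ideal.span {x})
      simp [hA] at h0
    · have := Module.free_of_hasProjectiveDimensionLT_of_smul_eq_zero hz hm n N hN
      exact ModuleCat.hasProjectiveDimensionLT_one_iff.2 inferInstance
  | succ h ih =>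
    rcases exists_isSMulRegular_or_exists_smul_eq_zero (A := A) A with ⟨x, hx, hreg⟩ | ⟨z, hz, hm⟩
    · have := nontrivial_quotient_span_singleton_of_mem hx
      have : IsLocalRing (A ⧸ Ideal.span {x}) :=
        IsLocalRing.of_surjective' (Ideal.Quotient.mk _) Ideal.Quotient.mk_surjective
      have hdim := ringKrullDim_quotient_span_singleton_succ_eq_ringKrullDim_of_mem_jacobson hreg
        (by rwa [IsLocalRing.ringJacobson_eq_maximalIdeal])
      rw [← hdim, ← Nat.cast_one, Nat.cast_add, Nat.cast_one,
        ← Nat.cast_one (R := WithBot ℕ∞), ENat.WithBot.add_le_add_natCast_right_iff] at hA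
      -- `x` need not be regular on `N`, but it is on the syzygy inside a free module; reduction
      -- modulo `x` preserves the projective dimension of the syzygy and lowers the dimension of the
      -- ring.
      obtain ⟨r, f, hf⟩ := Module.Finite.exists_fin' A N
      have hex := f.exact_subtype_ker_map
      have hinj := Submodule.subtype_injective (LinearMap.ker f)
      have hK : IsSMulRegular (LinearMap.ker f) x :=
        (IsSMulRegular.pi (f := fun _ : Fin r => A) fun _ => hreg).submodule _ _
      have hN' : HasProjectiveDimensionLT (ModuleCat.of A N) (n + 2) :=
        hasProjectiveDimensionLT_of_ge _ (n + 1) _ (Nat.le_succ _)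
      rw [hex.hasProjectiveDimensionLT_iff hinj hf n] at hN'
      refine (hex.hasProjectiveDimensionLT_iff hinj hf h).2
        ((hasProjectiveDimensionLT_quotSMulTop_iff hx hreg h _ hK).1 ?_)
      have : Module.Finite (A ⧸ Ideal.span {x}) (QuotSMulTop x (LinearMap.ker f)) :=
        Module.Finite.of_restrictScalars_finite A _ _
      refine ih _ hA _ (n := n) ((hasProjectiveDimensionLT_quotSMulTop_iff hx hreg n _ hK).2 hN')
    · have := Module.free_of_hasProjectiveDimensionLT_of_smul_eq_zero hz hm n N hN
      have : HasProjectiveDimensionLT (ModuleCat.of A N) 1 :=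
        ModuleCat.hasProjectiveDimensionLT_one_iff.2 inferInstance
      exact hasProjectiveDimensionLT_of_ge _ 1 _ (by omega)

open IsLocalRing RingTheory.Sequence in
/-- The inequality `pd M + depth M ≤ dim A` for modules of finite projective dimension. -/
lemma hasProjectiveDimensionLT_of_isWeaklyRegular {A : Type u} [CommRing A]
    [IsLocalRing A] [IsNoetherianRing A] {h : ℕ} (hA : ringKrullDim A ≤ h) (M : Type u)
    [AddCommGroup M] [Module A M] [Module.Finite A M] [Nontrivial M] {n : ℕ}
    (hM : HasProjectiveDimensionLT (ModuleCat.of A M) n) (rs : List A)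
    (hmem : ∀ r ∈ rs, r ∈ maximalIdeal A) (hreg : IsWeaklyRegular M rs) :
    HasProjectiveDimensionLT (ModuleCat.of A M) (h - rs.length + 1) := by
  have key := ModuleCat.projectiveDimension_quotient_eq_add_length_of_isWeaklyRegular
    (ModuleCat.of A M) rs hreg hmem
  have hM' : HasProjectiveDimensionLE (ModuleCat.of A M) n :=
    hasProjectiveDimensionLT_of_ge _ n _ n.le_succ
  have hq : HasProjectiveDimensionLE
      (ModuleCat.of A (M ⧸ Ideal.ofList rs • (⊤ : Submodule A M))) (n + rs.length) := by
    rw [← projectiveDimension_le_iff] at hM' ⊢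
    refine key.trans_le ?_
    push_cast
    gcongr
  -- The dimension bound is applied to `M/(rs)M`, whose projective dimension is `pd M + rs.length`.
  have hq' := hasProjectiveDimensionLT_of_ringKrullDim_le h A hA _ hq
  change HasProjectiveDimensionLE _ h at hq'
  change HasProjectiveDimensionLE _ _
  rw [← projectiveDimension_le_iff] at hq' hM' ⊢
  replace hq' := key.symm.trans_le hq'
  have hbot : projectiveDimension (ModuleCat.of A M) ≠ ⊥ := by
    rw [Ne, projectiveDimension_eq_bot_iff, ModuleCat.isZero_iff_subsingleton]
    exact not_subsingleton M
  generalize projectiveDimension (ModuleCat.of A M) = d at *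
  induction d with
  | bot => exact absurd rfl hbot
  | coe d =>
    induction d with
    | top =>
      have h1 : (⊤ : ℕ∞) ≤ (n : ℕ∞) := WithBot.coe_le_coe.1 hM'
      simp at h1
    | coe d =>
      have h1 : ((d + rs.length : ℕ) : ℕ∞) ≤ (h : ℕ∞) := WithBot.coe_le_coe.1 hq'
      have h2 : d + rs.length ≤ h := by exact_mod_cast h1
      exact WithBot.coe_le_coe.2 (Nat.cast_le.2 (by omega))

/-! ### Depth through vanishing of Ext from the residue field -/

section DepthGE

open IsLocalRing Abelian

variable (B : Type u) [CommRing B] [IsLocalRing B]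

/-- The cohomological form of "depth at least `t`" for a module over a local ring: the groups
`Extⁱ(κ, X)` vanish for `i < t`, where `κ` is the residue field. -/
def DepthGE (X : Type u) [AddCommGroup X] [Module B X] (t : ℕ) : Prop :=
  ∀ i < t, Subsingleton (Ext.{u} (ModuleCat.of B (ResidueField B)) (ModuleCat.of B X) i)

namespace DepthGE

variable {B} {K P M : Type u} [AddCommGroup K] [Module B K]
  [AddCommGroup P] [Module B P] [AddCommGroup M] [Module B M] {t : ℕ}

lemma mono {s : ℕ} (h : DepthGE B M t) (hs : s ≤ t) : DepthGE B M s :=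
  fun i hi => h i (hi.trans_le hs)

lemma of_linearEquiv (e : K ≃ₗ[B] M) (h : DepthGE B K t) : DepthGE B M t := fun i hi => by
  have := h i hi
  refine ⟨fun a b => ?_⟩
  have key (a : Ext.{u} (ModuleCat.of B (ResidueField B)) (ModuleCat.of B M) i) : a = 0 := by
    rw [← a.comp_mk₀_id, ← e.toModuleIso.inv_hom_id, ← Ext.mk₀_comp_mk₀,
      ← Ext.comp_assoc_of_third_deg_zero, Subsingleton.elim (a.comp _ _) 0, Ext.zero_comp]
  rw [key a, key b]

variable {f : K →ₗ[B] P} {g : P →ₗ[B] M}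

/-- `Extⁱ(κ, M)` sits between `Extⁱ(κ, P)` and `Extⁱ⁺¹(κ, K)`. -/
lemma of_exact_right (hex : Function.Exact f g) (hf : Function.Injective f)
    (hg : Function.Surjective g) (hK : DepthGE B K (t + 1)) (hP : DepthGE B P t) :
    DepthGE B M t := fun i hi => by
  have h1 := hK (i + 1) (by omega)
  have h2 := hP i hi
  have hS := hex.shortExact hf hg
  have key (a : Ext.{u} (ModuleCat.of B (ResidueField B)) (ModuleCat.of B M) i) : a = 0 := by
    obtain ⟨y, hy⟩ := Ext.covariant_sequence_exact₃ _ hS a rfl (h1.elim _ _)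
    rw [← hy, h2.elim y 0, Ext.zero_comp]
  exact ⟨fun a b => by rw [key a, key b]⟩

lemma of_exact_middle (hex : Function.Exact f g) (hf : Function.Injective f)
    (hg : Function.Surjective g) (hK : DepthGE B K t) (hM : DepthGE B M t) :
    DepthGE B P t := fun i hi => by
  have h1 := hK i hi
  have h2 := hM i hi
  have hS := hex.shortExact hf hg
  have key (a : Ext.{u} (ModuleCat.of B (ResidueField B)) (ModuleCat.of B P) i) : a = 0 := by
    obtain ⟨y, hy⟩ := Ext.covariant_sequence_exact₂ _ hS a (h2.elim _ _)
    rw [← hy, h1.elim y 0, Ext.zero_comp]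
  exact ⟨fun a b => by rw [key a, key b]⟩

lemma of_subsingleton [Subsingleton M] : DepthGE B M t := fun i _ => by
  have hz : Limits.IsZero (ModuleCat.of B M) := ModuleCat.isZero_of_subsingleton _
  have key (a : Ext.{u} (ModuleCat.of B (ResidueField B)) (ModuleCat.of B M) i) : a = 0 := by
    rw [← a.comp_mk₀_id, hz.eq_of_src (𝟙 _) 0, Ext.mk₀_zero, Ext.comp_zero]
  exact ⟨fun a b => by rw [key a, key b]⟩

lemma pi_fin (h : DepthGE B M t) (r : ℕ) : DepthGE B (Fin r → M) t := by
  induction r with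
  | zero => exact of_subsingleton
  | succ r ih =>
    have : DepthGE B (M × (Fin r → M)) t :=
      of_exact_middle (f := LinearMap.inl B M (Fin r → M)) (g := LinearMap.snd B M (Fin r → M))
        .inl_snd LinearMap.inl_injective LinearMap.snd_surjective h ih
    exact of_linearEquiv (Fin.consLinearEquiv B fun _ : Fin (r + 1) => M) this

/-- Since `x` kills `κ`, it acts as zero on `Ext(κ, P)`; hence every class comes from `Ext(κ, M)`
one degree lower, and in degree 0 it vanishes because `x` is injective on `P`. -/
lemma succ_of_exact_lsmul {x : B} (hx : x ∈ maximalIdeal B) {g : P →ₗ[B] M}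
    (hex : Function.Exact (LinearMap.lsmul B P x) g) (hreg : IsSMulRegular P x)
    (hg : Function.Surjective g) (hM : DepthGE B M t) : DepthGE B P (t + 1) := fun i hi => by
  have hS := hex.shortExact hreg hg
  have key (a : Ext.{u} (ModuleCat.of B (ResidueField B)) (ModuleCat.of B P) i) : a = 0 := by
    have hxa : a.comp (Ext.mk₀ hex.shortComplex.f) (add_zero i) = 0 := by
      have e := Ext.postcomp_smul_id_eq_zero_of_mem_annihilator (R := B)
        (N := ModuleCat.of B (ResidueField B)) (M := ModuleCat.of B P) (r := x) (by
          have := Ideal.annihilator_quotient (I := maximalIdeal B)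
          exact this.symm ▸ hx) i
      exact congr($(e).hom a)
    cases i with
    | zero =>
      have := hS.mono_f
      obtain ⟨φ, rfl⟩ := (Ext.mk₀_bijective _ _).2 a
      rw [Ext.mk₀_comp_mk₀, Ext.mk₀_eq_zero_iff] at hxa
      have : φ = 0 := by
        rw [← cancel_mono hex.shortComplex.f]
        exact hxa.trans Limits.zero_comp.symm
      rw [this, Ext.mk₀_zero]
    | succ i =>
      obtain ⟨y, hy⟩ := Ext.covariant_sequence_exact₁ _ hS a hxa rfl
      rw [← hy, (hM i (by omega)).elim y 0, Ext.zero_comp]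
  exact ⟨fun a b => by rw [key a, key b]⟩

lemma subsingleton_linearMap (h : DepthGE B M 1) : Subsingleton (ResidueField B →ₗ[B] M) := by
  have : Subsingleton (ModuleCat.of B (ResidueField B) ⟶ ModuleCat.of B M) :=
    Ext.addEquiv₀.subsingleton_congr.mp (h 0 zero_lt_one)
  let e : (ModuleCat.of B (ResidueField B) ⟶ ModuleCat.of B M) ≃+
    (ResidueField B →ₗ[B] M) := ModuleCat.homAddEquiv
  exact e.symm.subsingleton

lemma maximalIdeal_notMem_associatedPrimes [IsNoetherianRing B] [Module.Finite B M]
    (h : DepthGE B M 1) : maximalIdeal B ∉ associatedPrimes B M := by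
  obtain ⟨r, hr, hreg⟩ := IsSMulRegular.subsingleton_linearMap_iff.1 h.subsingleton_linearMap
  have hr' : r ∈ maximalIdeal B := by
    have := Ideal.annihilator_quotient (I := maximalIdeal B)
    exact this ▸ hr
  intro hass
  have h1 : r ∈ ⋃ p ∈ associatedPrimes B M, (p : Set B) :=
    Set.mem_biUnion hass hr'
  rw [biUnion_associatedPrimes_eq_compl_regular] at h1
  exact h1 hreg

open RingTheory.Sequence

lemma exists_isRegular [IsNoetherianRing B] [Module.Finite B M] [Nontrivial M]
    (h : DepthGE B M t) : ∃ rs : List B, rs.length = t ∧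
      (∀ r ∈ rs, r ∈ maximalIdeal B) ∧ IsRegular M rs := by
  refine ModuleCat.exists_isRegular_of_exists_subsingleton_ext (maximalIdeal B) t
    (ModuleCat.of B M) ?_ (ModuleCat.of B (ResidueField B)) ?_ h
  · exact (Submodule.top_ne_ideal_smul_of_le_jacobson_annihilator
      (maximalIdeal_le_jacobson _)).symm.lt_top
  · have := Ideal.annihilator_quotient (I := maximalIdeal B)
    change Module.support B (B ⧸ maximalIdeal B) = _
    rw [Module.support_eq_zeroLocus, this]

lemma of_isRegular [IsNoetherianRing B] [Module.Finite B M] [Nontrivial M] (rs : List B)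
    (hmem : ∀ r ∈ rs, r ∈ maximalIdeal B) (h : IsRegular M rs) : DepthGE B M rs.length := by
  refine ModuleCat.subsingleton_ext_of_exists_isRegular (maximalIdeal B)
    (ModuleCat.of B (ResidueField B)) ?_ (ModuleCat.of B M) ?_ rs hmem h
  · have := Ideal.annihilator_quotient (I := maximalIdeal B)
    change Module.support B (B ⧸ maximalIdeal B) ⊆ _
    rw [Module.support_eq_zeroLocus, this]
  · exact (Submodule.top_ne_ideal_smul_of_le_jacobson_annihilator
      (maximalIdeal_le_jacobson _)).symm.lt_top

end DepthGE

end DepthGE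

/-- If twice the depth of a noetherian local ring is at least `h`, so is twice the cohomological
depth. -/
lemma depthGE_of_le_two_mul_localDepth (B : Type u) [CommRing B] [IsLocalRing B]
    [IsNoetherianRing B] (t h : ℕ) (ht : 2 * t ≤ h + 1)
    (hB : (h : ℕ∞) ≤ 2 * localDepth B) : DepthGE B B t := by
  rcases Nat.eq_zero_or_pos t with rfl | hpos
  · exact fun i hi => absurd hi (Nat.not_lt_zero i)
  obtain ⟨rs, hmem, hreg, hlen⟩ : ∃ rs : List B, (∀ r ∈ rs, r ∈ IsLocalRing.maximalIdeal B) ∧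
      RingTheory.Sequence.IsRegular B rs ∧ t ≤ rs.length := by
    -- If all regular sequences were shorter than `t`, then `h ≤ 2(t - 1)`, against `2t ≤ h + 1`.
    by_contra! hcon
    have hle : localDepth B ≤ ((t - 1 : ℕ) : ℕ∞) := by
      refine sSup_le ?_
      rintro n ⟨rs, hmem, hreg, rfl⟩
      have := hcon rs hmem hreg
      exact_mod_cast Nat.le_sub_one_of_lt this
    have h2 : (h : ℕ∞) ≤ 2 * ((t - 1 : ℕ) : ℕ∞) := hB.trans (by gcongr)
    have h3 : h ≤ 2 * (t - 1) := by exact_mod_cast h2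
    omega
  exact (DepthGE.of_isRegular rs hmem hreg).mono hlen

/-! ### Depth at a prime of the base and at the primes above it -/

section Transfer

open IsLocalRing

section Localized

variable {S : Type u} [CommRing S] (p : Ideal S) [p.IsPrime] {X Y : Type u} [AddCommGroup X]
  [Module S X] [AddCommGroup Y] [Module S Y] {x : S} {g : X →ₗ[S] Y}

lemma LocalizedModule.map_exact' {Z : Type u} [AddCommGroup Z] [Module S Z] {f : Z →ₗ[S] X}
    (hex : Function.Exact f g) : Function.Exact (LocalizedModule.map p.primeCompl f)
      (LocalizedModule.map p.primeCompl g) :=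
  LocalizedModule.map_exact p.primeCompl f g hex

lemma LocalizedModule.mk_eq_zero_iff (y : X) (s : p.primeCompl) :
    LocalizedModule.mk y s = 0 ↔ ∃ u : p.primeCompl, u • y = 0 := by
  rw [← LocalizedModule.zero_mk 1, LocalizedModule.mk_eq]
  simp

/-- Regularity is only asked up to elements outside `p`, so that `x` can be taken in `S` itself and
quotients can be formed before localizing. -/
lemma LocalizedModule.isSMulRegular_of_forall
    (hreg : ∀ y : X, x • y = 0 → ∃ u ∈ p.primeCompl, u • y = 0) :
    IsSMulRegular (LocalizedModule p.primeCompl X)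
      (algebraMap S (Localization.AtPrime p) x) := by
  refine IsSMulRegular.of_right_eq_zero_of_smul fun y hy => ?_
  induction y using LocalizedModule.induction_on with
  | _ y s =>
    rw [algebraMap_smul, LocalizedModule.smul'_mk, LocalizedModule.mk_eq_zero_iff] at hy
    obtain ⟨u, hu⟩ := hy
    obtain ⟨v, hv, hvy⟩ := hreg ((u : S) • y) (by rw [smul_comm]; exact hu)
    rw [LocalizedModule.mk_eq_zero_iff]
    exact ⟨⟨v, hv⟩ * u, by rw [mul_smul]; exact hvy⟩

lemma LocalizedModule.exact_lsmul_map (hex : Function.Exact (LinearMap.lsmul S X x) g) :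
    Function.Exact (LinearMap.lsmul (Localization.AtPrime p) (LocalizedModule p.primeCompl X)
      (algebraMap S (Localization.AtPrime p) x)) (LocalizedModule.map p.primeCompl g) := by
  have h := LocalizedModule.map_exact' p hex
  convert h using 1
  ext y
  induction y using LocalizedModule.induction_on with
  | _ y s =>
    rw [LocalizedModule.map_mk, LinearMap.lsmul_apply, algebraMap_smul, LocalizedModule.smul'_mk,
      LinearMap.lsmul_apply]

lemma DepthGE.localized_quotient (hex : Function.Exact (LinearMap.lsmul S X x) g)
    (hg : Function.Surjective g) (hreg : ∀ y : X, x • y = 0 → ∃ u ∈ p.primeCompl, u • y = 0)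
    {t : ℕ} (h : DepthGE (Localization.AtPrime p) (LocalizedModule p.primeCompl X) (t + 1)) :
    DepthGE (Localization.AtPrime p) (LocalizedModule p.primeCompl Y) t :=
  DepthGE.of_exact_right (LocalizedModule.exact_lsmul_map p hex)
    (LocalizedModule.isSMulRegular_of_forall p hreg) (LocalizedModule.map_surjective _ _ hg) h
    (h.mono t.le_succ)

lemma DepthGE.localized_of_quotient (hx : x ∈ p)
    (hex : Function.Exact (LinearMap.lsmul S X x) g)
    (hg : Function.Surjective g) (hreg : ∀ y : X, x • y = 0 → ∃ u ∈ p.primeCompl, u • y = 0)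
    {t : ℕ} (h : DepthGE (Localization.AtPrime p) (LocalizedModule p.primeCompl Y) t) :
    DepthGE (Localization.AtPrime p) (LocalizedModule p.primeCompl X) (t + 1) :=
  DepthGE.succ_of_exact_lsmul
    ((IsLocalization.AtPrime.to_map_mem_maximal_iff (Localization.AtPrime p) p x).2 hx)
    (LocalizedModule.exact_lsmul_map p hex)
    (LocalizedModule.isSMulRegular_of_forall p hreg) (LocalizedModule.map_surjective _ _ hg) h

lemma exists_mem_regular_of_notMem_associatedPrimes [IsNoetherianRing S] [Module.Finite S X]
    (hp : p ∉ associatedPrimes S X) :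
    ∃ x ∈ p, ∀ y : X, x • y = 0 → ∃ u ∈ p.primeCompl, u • y = 0 := by
  rcases exists_isSMulRegular_or_exists_smul_eq_zero (A := Localization.AtPrime p)
    (LocalizedModule p.primeCompl X) with ⟨r, hr, hreg⟩ | ⟨z, hz, hm⟩
  · obtain ⟨x, s, rfl⟩ := IsLocalization.exists_mk'_eq p.primeCompl r
    rw [IsLocalization.AtPrime.mk'_mem_maximal_iff _ p] at hr
    refine ⟨x, hr, fun y hy => ?_⟩
    have h0 : LocalizedModule.mkLinearMap p.primeCompl X y = 0 := by
      refine hreg.right_eq_zero_of_smul ?_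
      rw [LocalizedModule.mkLinearMap_apply, ← Localization.mk_eq_mk', LocalizedModule.mk_smul_mk,
        hy, LocalizedModule.zero_mk]
    obtain ⟨u, hu⟩ := (IsLocalizedModule.eq_zero_iff p.primeCompl _).1 h0
    exact ⟨u, u.2, hu⟩
  · refine absurd ?_ hp
    have hass : maximalIdeal (Localization.AtPrime p) ∈
        associatedPrimes (Localization.AtPrime p) (LocalizedModule p.primeCompl X) := by
      refine isAssociatedPrime_iff.2 ⟨(maximalIdeal.isMaximal _).isPrime, z, ?_⟩
      ext a
      rw [Submodule.mem_colon_singleton, Submodule.mem_bot]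
      refine ⟨hm a, fun ha => ?_⟩
      by_contra hu
      have hu' : IsUnit a := by simpa using hu
      exact hz (hu'.smul_eq_zero.1 ha)
    have := Module.associatedPrimes.comap_mem_associatedPrimes_of_mem_associatedPrimes_of_isLocalizedModule_of_fg
      p.primeCompl (LocalizedModule.mkLinearMap p.primeCompl X) _ hass
      ((isNoetherianRing_iff_ideal_fg S).1 inferInstance _)
    rwa [← Ideal.under_def, Localization.AtPrime.under_maximalIdeal] at this

lemma DepthGE.notMem_associatedPrimes [IsNoetherianRing S] [Module.Finite S X]
    (h : DepthGE (Localization.AtPrime p) (LocalizedModule p.primeCompl X) 1) :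
    p ∉ associatedPrimes S X := fun hp =>
  h.maximalIdeal_notMem_associatedPrimes
    (Module.associatedPrimes.mem_associatedPrimes_atPrime_of_mem_associatedPrimes hp)

end Localized

variable {A R : Type u} [CommRing A] [CommRing R] [Algebra A R]

/-- If `m` is the annihilator of `y` in `A`, it is the contraction of the annihilator of `R ∙ y`;
some prime minimal over the latter contracts to `m`, and it is associated to `X`. -/
lemma exists_mem_associatedPrimes_comap_eq [IsNoetherianRing A] [IsNoetherianRing R] {X : Type u}
    [AddCommGroup X] [Module R X] [Module A X] [IsScalarTower A R X] [Module.Finite R X]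
    {m : Ideal A} (hm : m ∈ associatedPrimes A X) :
    ∃ p ∈ associatedPrimes R X, p.comap (algebraMap A R) = m := by
  obtain ⟨hprime, y, hy⟩ := isAssociatedPrime_iff.1 hm
  let N : Submodule R X := R ∙ y
  have hcomap : (Module.annihilator R N).comap (algebraMap A R) = m := by
    ext a
    rw [hy, Ideal.mem_comap, Submodule.mem_annihilator_span_singleton,
      Submodule.mem_colon_singleton, algebraMap_smul, Submodule.mem_bot]
  have hmin : m ∈ ((Module.annihilator R N).comap (algebraMap A R)).minimalPrimes := by
    rw [hcomap, Ideal.minimalPrimes_eq_subsingleton_self]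
    rfl
  obtain ⟨p, hp, hpm⟩ := Ideal.exists_minimalPrimes_comap_eq _ m hmin
  exact ⟨p, associatedPrimes.subset_of_injective N.subtype_injective
    (Module.associatedPrimes.minimalPrimes_annihilator_subset_associatedPrimes R N hp), hpm⟩

/-- Depth over the base of a finite algebra can be computed at the primes lying over. -/
lemma DepthGE.of_forall_comap_eq [IsNoetherianRing A] [IsNoetherianRing R] [Module.Finite A R]
    (m : Ideal A) [m.IsPrime] (t : ℕ) (X : Type u) [AddCommGroup X] [Module R X] [Module A X]
    [IsScalarTower A R X] [Module.Finite R X]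
    (h : ∀ (p : Ideal R) [p.IsPrime], p.comap (algebraMap A R) = m →
      DepthGE (Localization.AtPrime p) (LocalizedModule p.primeCompl X) t) :
    DepthGE (Localization.AtPrime m) (LocalizedModule m.primeCompl X) t := by
  induction t generalizing X with
  | zero => exact fun i hi => absurd hi (Nat.not_lt_zero i)
  | succ t ih =>
    have : Module.Finite A X := Module.Finite.trans R X
    have hm : m ∉ associatedPrimes A X := fun hm => by
      obtain ⟨p, hp, hpm⟩ := exists_mem_associatedPrimes_comap_eq (R := R) hm
      have := hp.isPrime
      exact ((h p hpm).mono (by omega)).notMem_associatedPrimes p hp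
    obtain ⟨x, hx, hreg⟩ := exists_mem_regular_of_notMem_associatedPrimes m hm
    let Y := X ⧸ LinearMap.range (LinearMap.lsmul R X (algebraMap A R x))
    let g : X →ₗ[R] Y := Submodule.mkQ _
    have hex : Function.Exact (LinearMap.lsmul R X (algebraMap A R x)) g :=
      LinearMap.exact_map_mkQ_range _
    have hg : Function.Surjective g := Submodule.mkQ_surjective _
    have hexA : Function.Exact (LinearMap.lsmul A X x) (g.restrictScalars A) := by
      intro y
      refine (hex y).trans ?_
      simp [Set.mem_range]
    refine DepthGE.localized_of_quotient m hx hexA hg hreg (ih Y fun p _ hpm => ?_)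
    -- Elements of `A` outside `m` map outside `p`, so `x` is also regular at `p`, and passing to
    -- `Y` costs one unit of depth at every such `p`.
    refine DepthGE.localized_quotient p hex hg (fun y hy => ?_) (h p hpm)
    rw [algebraMap_smul] at hy
    obtain ⟨u, hu, huy⟩ := hreg y hy
    refine ⟨algebraMap A R u, fun hup => hu ?_, by rwa [algebraMap_smul]⟩
    rw [← hpm]
    exact hup

end Transfer

/-! ### Equidimensionality, normality and going down -/

section Dimension

lemma ringKrullDim_le_of_isIntegral (B C : Type*) [CommRing B] [CommRing C] [Algebra B C]
    [Algebra.IsIntegral B C] : ringKrullDim C ≤ ringKrullDim B :=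
  Order.krullDim_le_of_strictMono (PrimeSpectrum.comap (algebraMap B C)) fun _ _ h =>
    Ideal.IsIntegral.comap_lt_comap h

lemma ringKrullDim_le_of_isIntegral_of_injective {B C : Type*} [CommRing B] [CommRing C]
    [Algebra B C] [Algebra.IsIntegral B C] (h : Function.Injective (algebraMap B C)) :
    ringKrullDim B ≤ ringKrullDim C := by
  refine iSup_le fun l => ?_
  obtain ⟨P, -, hP, hPl⟩ := Ideal.exists_ideal_over_prime_of_isIntegral l.head.asIdeal (⊥ : Ideal C)
    (by
      intro x hx
      rw [Ideal.mem_comap, Ideal.mem_bot, map_eq_zero_iff _ h] at hx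
      rw [hx]; exact zero_mem _)
  have : P.LiesOver l.head.asIdeal := ⟨hPl.symm⟩
  obtain ⟨L, hL, -⟩ := Ideal.exists_ltSeries_of_hasGoingUp l P
  rw [← hL]
  exact Order.LTSeries.length_le_krullDim L

variable {A R : Type*} [CommRing A] [CommRing R] [Algebra A R]

/-- Integrality gives `dim A/(q ∩ A) = dim R/q = d` for every minimal `q`. A minimal prime of `A`
strictly below `q ∩ A` would also be contracted from a minimal prime of `R`, and two comparable
distinct primes cannot have quotients of the same finite dimension. -/
lemma IsEquidimensional.comap_mem_minimalPrimes [Algebra.IsIntegral A R]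
    (hinj : Function.Injective (algebraMap A R)) (h : IsEquidimensional R) {q : Ideal R}
    (hq : q ∈ minimalPrimes R) : q.under A ∈ minimalPrimes A := by
  obtain ⟨d, hd⟩ := h
  have hqp : q.IsPrime := hq.1.1
  have hdim (q : Ideal R) (hq : q ∈ minimalPrimes R) : ringKrullDim (A ⧸ q.under A) = d := by
    have hqp : q.IsPrime := hq.1.1
    rw [← hd q hq]
    refine le_antisymm (ringKrullDim_le_of_isIntegral_of_injective ?_)
      (ringKrullDim_le_of_isIntegral _ _)
    exact FaithfulSMul.algebraMap_injective (A ⧸ q.under A) (R ⧸ q)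
  obtain ⟨n, hn, hnq⟩ := Ideal.exists_minimalPrimes_le (I := (⊥ : Ideal A)) (J := q.under A) bot_le
  have hn' : n ∈ ((⊥ : Ideal R).comap (algebraMap A R)).minimalPrimes := by
    rwa [Ideal.comap_bot_of_injective _ hinj]
  obtain ⟨q', hq', rfl⟩ := Ideal.exists_minimalPrimes_comap_eq _ n hn'
  have hq'p : q'.IsPrime := hq'.1.1
  by_contra hcon
  have hne : q'.under A ≠ q.under A := fun he => hcon (he ▸ hn)
  obtain ⟨a, ha, ha'⟩ := Set.exists_of_ssubset ((show q'.under A ≤ q.under A from hnq).lt_of_ne hne)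
  have hle := ringKrullDim_succ_le_of_surjective (R := A ⧸ q'.under A) (S := A ⧸ q.under A)
    (Ideal.Quotient.factor hnq) (Ideal.Quotient.factor_surjective hnq)
    (r := Ideal.Quotient.mk _ a)
    (mem_nonZeroDivisors_of_ne_zero (by rwa [Ne, Ideal.Quotient.eq_zero_iff_mem]))
    (by rwa [Ideal.Quotient.factor_mk, Ideal.Quotient.eq_zero_iff_mem])
  rw [hdim q hq, hdim q' hq'] at hle
  have : ((d + 1 : ℕ) : WithBot ℕ∞) ≤ (d : ℕ) := by exact_mod_cast hle
  have : d + 1 ≤ d := by exact_mod_cast this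
  omega

/-- If the localization at `m` is a domain, the minimal prime inside `m` is the kernel of the
localization map. -/
lemma mem_minimalPrimes_iff_of_isDomain_localization {m n : Ideal A} [m.IsPrime]
    [IsDomain (Localization.AtPrime m)] (hn : n ∈ minimalPrimes A) (hnm : n ≤ m) (a : A) :
    a ∈ n ↔ algebraMap A (Localization.AtPrime m) a = 0 := by
  have hnp : n.IsPrime := hn.1.1
  have key (n : Ideal A) [n.IsPrime] (hnm : n ≤ m) :
      RingHom.ker (algebraMap A (Localization.AtPrime m)) ≤ n := fun a ha => by
    rw [RingHom.mem_ker, IsLocalization.map_eq_zero_iff m.primeCompl] at ha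
    obtain ⟨s, hs⟩ := ha
    exact ((‹n.IsPrime›.mem_or_mem (hs.symm ▸ zero_mem n)).resolve_left fun h => s.2 (hnm h))
  have hker : (RingHom.ker (algebraMap A (Localization.AtPrime m))).IsPrime := RingHom.ker_isPrime _
  exact ⟨fun h => hn.2 ⟨hker, bot_le⟩ (key n hnm) h, fun h => key n hnm h⟩

/-- Since `A_m` is a domain, `n` is the kernel of `A → A_m` for every prime `m` containing it, so
the localizations of `A/n` are localizations of `A`. -/
lemma IsNormalRing.isIntegrallyClosed_quotient (hA : IsNormalRing A) {n : Ideal A} [n.IsPrime]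
    (hn : n ∈ minimalPrimes A) : IsIntegrallyClosed (A ⧸ n) := by
  refine IsIntegrallyClosed.of_localization_maximal fun p' _ _ => ?_
  let m := p'.comap (Ideal.Quotient.mk n)
  have := hA.isDomain m
  have := hA.isIntegrallyClosed m
  have hnm : n ≤ m := fun a ha => by
    rw [Ideal.mem_comap, Ideal.Quotient.eq_zero_iff_mem.2 ha]
    exact zero_mem _
  refine IsIntegrallyClosed.of_equiv (RingEquiv.ofBijective
    (Localization.localRingHom m p' (Ideal.Quotient.mk n) rfl) ⟨?_, ?_⟩)
  · rw [injective_iff_map_eq_zero]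
    intro x hx
    obtain ⟨a, s, rfl⟩ := IsLocalization.exists_mk'_eq m.primeCompl x
    rw [Localization.localRingHom_mk', IsLocalization.mk'_eq_zero_iff] at hx
    obtain ⟨⟨t, ht⟩, hta⟩ := hx
    obtain ⟨t, rfl⟩ := Ideal.Quotient.mk_surjective t
    rw [← map_mul, Ideal.Quotient.eq_zero_iff_mem,
      mem_minimalPrimes_iff_of_isDomain_localization hn hnm, map_mul] at hta
    have ht' : t ∈ m.primeCompl := ht
    rw [IsLocalization.mk'_eq_zero_iff]
    rw [← map_mul, IsLocalization.map_eq_zero_iff m.primeCompl] at hta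
    obtain ⟨u, hu⟩ := hta
    exact ⟨u * ⟨t, ht'⟩, by rw [← hu]; push_cast; ring⟩
  · exact (RingHom.surjectiveOnStalks_of_surjective
      Ideal.Quotient.mk_surjective).localRingHom_surjective _ _ _

lemma IsNormalRing.hasGoingDown [Algebra.IsIntegral A R] (hA : IsNormalRing A)
    (hinj : Function.Injective (algebraMap A R)) (h : IsEquidimensional R) :
    Algebra.HasGoingDown A R where
  exists_ideal_le_liesOver_of_lt {p0} _ Q _ hlt := by
    obtain ⟨q, hq, hqQ⟩ := Ideal.exists_minimalPrimes_le (I := (⊥ : Ideal R)) (J := Q) bot_le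
    have hqp : q.IsPrime := hq.1.1
    have hn := h.comap_mem_minimalPrimes hinj hq
    have := hA.isIntegrallyClosed_quotient hn
    have hnm : q.under A ≤ Q.under A := Ideal.comap_mono hqQ
    -- The prime `Q ∩ A` contains only one minimal prime, as its localization is a domain; so `q ∩
    -- A` also lies in `p0`.
    have hnp : q.under A ≤ p0 := by
      obtain ⟨n', hn', hle⟩ := Ideal.exists_minimalPrimes_le (I := (⊥ : Ideal A)) (J := p0) bot_le
      have := hA.isDomain (Q.under A)
      intro a ha
      rw [mem_minimalPrimes_iff_of_isDomain_localization hn hnm] at ha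
      exact hle ((mem_minimalPrimes_iff_of_isDomain_localization hn' (hle.trans hlt.le) a).2 ha)
    let f := Ideal.Quotient.mk (q.under A)
    let g := Ideal.Quotient.mk q
    have hcomm : g.comp (algebraMap A R) = (algebraMap (A ⧸ q.under A) (R ⧸ q)).comp f := rfl
    have hp0 : (p0.map f).comap f = p0 := by
      rw [Ideal.comap_map_of_surjective' f Ideal.Quotient.mk_surjective, Ideal.mk_ker,
        sup_eq_left.2 hnp]
    have hQ : (Q.map g).comap g = Q := by
      rw [Ideal.comap_map_of_surjective' g Ideal.Quotient.mk_surjective, Ideal.mk_ker,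
        sup_eq_left.2 hqQ]
    have : (p0.map f).IsPrime := Ideal.map_isPrime_of_surjective Ideal.Quotient.mk_surjective
      (by rwa [Ideal.mk_ker])
    have : (Q.map g).IsPrime := Ideal.map_isPrime_of_surjective Ideal.Quotient.mk_surjective
      (by rwa [Ideal.mk_ker])
    have hQA : ((Q.map g).under (A ⧸ q.under A)).comap f = Q.under A := by
      change ((Q.map g).comap (algebraMap (A ⧸ q.under A) (R ⧸ q))).comap f = Q.comap _
      rw [Ideal.comap_comap, ← hcomm, ← Ideal.comap_comap, hQ]
    have hlt' : p0.map f < (Q.map g).under (A ⧸ q.under A) := by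
      refine lt_of_le_of_ne ?_ fun he => ?_
      · rw [Ideal.map_le_iff_le_comap, hQA]
        exact hlt.le
      · rw [← he, hp0] at hQA
        exact hlt.ne hQA
    -- Classical going down for the integral extension of domains `A/(q ∩ A) ⊆ R/q` with integrally
    -- closed base.
    obtain ⟨P, hPQ, hP, hPo⟩ := Algebra.HasGoingDown.exists_ideal_le_liesOver_of_lt _ hlt'
    refine ⟨P.comap g, (Ideal.comap_mono hPQ).trans hQ.le, inferInstance, ⟨?_⟩⟩
    rw [Ideal.under_def, Ideal.comap_comap, hcomm, ← Ideal.comap_comap, ← Ideal.under_def,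
      ← hPo.over, hp0]

end Dimension

/-! ### Tor-independence by induction on projective dimension -/

section Induction

open TensorProduct

variable {A : Type u} [CommRing A]

section

variable (m : Ideal A) [m.IsPrime] {K P M N : Type u} [AddCommGroup K] [Module A K]
  [AddCommGroup P] [Module A P] [AddCommGroup M] [Module A M] [AddCommGroup N] [Module A N]

lemma LocalizedModule.projective (P : Type u) [AddCommGroup P] [Module A P]
    [Module.Projective A P] :
    Module.Projective (Localization.AtPrime m) (LocalizedModule m.primeCompl P) :=
  Module.projective_of_isLocalizedModule m.primeCompl (LocalizedModule.mkLinearMap m.primeCompl P)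

lemma LocalizedModule.hasProjectiveDimensionLT {n : ℕ}
    (hM : HasProjectiveDimensionLT (ModuleCat.of A M) (n + 1)) :
    HasProjectiveDimensionLT
      (ModuleCat.of (Localization.AtPrime m) (LocalizedModule m.primeCompl M)) (n + 1) := by
  induction n generalizing M with
  | zero =>
    have := ModuleCat.hasProjectiveDimensionLT_one_iff.1 hM
    exact ModuleCat.hasProjectiveDimensionLT_one_iff.2 (LocalizedModule.projective m M)
  | succ n ih =>
    have step (P : Type u) [AddCommGroup P] [Module A P] [Module.Projective A P] (f : P →ₗ[A] M)
        (hf : Function.Surjective f) : HasProjectiveDimensionLT (ModuleCat.of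
          (Localization.AtPrime m) (LocalizedModule m.primeCompl M)) (n + 2) := by
      have hex : Function.Exact (LinearMap.ker f).subtype f := LinearMap.exact_subtype_ker_map f
      have hinj := (LinearMap.ker f).subtype_injective
      have := LocalizedModule.projective m P
      exact ((LocalizedModule.map_exact' m hex).hasProjectiveDimensionLT_iff
        (LocalizedModule.map_injective _ _ hinj) (LocalizedModule.map_surjective _ _ hf) n).2
        (ih ((hex.hasProjectiveDimensionLT_iff hinj hf n).1 hM))
    exact step (M →₀ A) (Finsupp.linearCombination A id)
      (Finsupp.linearCombination_surjective A Function.surjective_id)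

/-- If `M` becomes free at a prime, the depth of `N ⊗ M` at that prime is at least that of `N`. -/
lemma DepthGE.localized_tensorProduct [Module.Finite A M]
    [Module.Projective (Localization.AtPrime m) (LocalizedModule m.primeCompl M)] {t : ℕ}
    (h : DepthGE (Localization.AtPrime m) (LocalizedModule m.primeCompl N) t) :
    DepthGE (Localization.AtPrime m) (LocalizedModule m.primeCompl (N ⊗[A] M)) t := by
  have : Module.Free (Localization.AtPrime m) (LocalizedModule m.primeCompl M) :=
    Module.free_of_flat_of_isLocalRing
  let b := Module.finBasis (Localization.AtPrime m) (LocalizedModule m.primeCompl M)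
  let e₁ : LocalizedModule m.primeCompl (N ⊗[A] M) ≃ₗ[A]
      LocalizedModule m.primeCompl N ⊗[A] LocalizedModule m.primeCompl M :=
    IsLocalizedModule.iso m.primeCompl (TensorProduct.map
      (LocalizedModule.mkLinearMap m.primeCompl N) (LocalizedModule.mkLinearMap m.primeCompl M))
  let e₂ := e₁.extendScalarsOfIsLocalization m.primeCompl (Localization.AtPrime m)
  let e₃ := IsLocalization.moduleTensorEquiv m.primeCompl (Localization.AtPrime m)
    (LocalizedModule m.primeCompl N) (LocalizedModule m.primeCompl M)
  let e₄ := TensorProduct.congr (LinearEquiv.refl (Localization.AtPrime m)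
    (LocalizedModule m.primeCompl N)) b.equivFun
  let e₅ := TensorProduct.piScalarRight (Localization.AtPrime m) (Localization.AtPrime m)
    (LocalizedModule m.primeCompl N) (Fin (Module.finrank (Localization.AtPrime m)
      (LocalizedModule m.primeCompl M)))
  exact (h.pi_fin _).of_linearEquiv (e₅.symm ≪≫ₗ e₄.symm ≪≫ₗ e₃ ≪≫ₗ e₂.symm)

/-- If `M` becomes projective at a prime `m`, then `m` is not associated to the kernel of
`N ⊗ K → N ⊗ P`. -/
lemma notMem_associatedPrimes_ker_lTensor [IsNoetherianRing A] [Module.Finite A P]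
    [Module.Finite A K] (N : Type u) [AddCommGroup N] [Module A N]
    {i : K →ₗ[A] P} {g : P →ₗ[A] M} (hex : Function.Exact i g)
    (hi : Function.Injective i) (hg : Function.Surjective g)
    [Module.Projective (Localization.AtPrime m) (LocalizedModule m.primeCompl M)] :
    m ∉ associatedPrimes A (LinearMap.ker (i.lTensor N)) := by
  intro hm
  have := Module.finitePresentation_of_finite A P
  have hgm := LocalizedModule.map_surjective m.primeCompl g hg
  -- `K_m → P_m` has a retraction `ρ`. Clearing denominators gives `h : P → K` with `τ • (h ∘ i) =
  -- τσ • id`; thus `τσ`, which is outside `m`, kills the kernel of `N ⊗ i`.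
  obtain ⟨ρ, hρ⟩ := ((LocalizedModule.map_exact' m hex).split_tfae
    (LocalizedModule.map_injective _ _ hi) hgm).out 0 1 |>.1
    (Module.projective_lifting_property _ LinearMap.id hgm)
  obtain ⟨h, σ, hσ⟩ := Module.FinitePresentation.exists_lift_of_isLocalizedModule m.primeCompl
    (LocalizedModule.mkLinearMap m.primeCompl K)
    (ρ.restrictScalars A ∘ₗ LocalizedModule.mkLinearMap m.primeCompl P)
  obtain ⟨τ, hτ⟩ := Module.Finite.exists_smul_of_comp_eq_of_isLocalizedModule m.primeCompl
    (LocalizedModule.mkLinearMap m.primeCompl K) (h ∘ₗ i) (σ • LinearMap.id) (by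
      ext k
      have h1 := LinearMap.congr_fun hσ (i k)
      have h2 := LinearMap.congr_fun hρ (LocalizedModule.mk k 1)
      rw [LinearMap.comp_apply, LocalizedModule.map_mk, LinearMap.id_apply] at h2
      simp only [LinearMap.comp_apply, LinearMap.smul_apply, LinearMap.restrictScalars_apply,
        LocalizedModule.mkLinearMap_apply, LinearMap.id_apply] at h1 ⊢
      rw [h1, h2, ← LocalizedModule.mkLinearMap_apply, ← LocalizedModule.mkLinearMap_apply,
        Submonoid.smul_def, Submonoid.smul_def, map_smul])
  obtain ⟨hprime, y, hy⟩ := isAssociatedPrime_iff.1 hm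
  have hann : (τ * σ : A) • y = 0 := by
    ext
    have h3 : (τ * σ : A) • LinearMap.id = (τ : A) • (h ∘ₗ i) := by
      rw [mul_smul]
      exact hτ.symm
    have h4 : ((τ * σ : A) • LinearMap.id : K →ₗ[A] K).lTensor N y.1 = 0 := by
      rw [h3, LinearMap.lTensor_smul, LinearMap.lTensor_comp, LinearMap.smul_apply,
        LinearMap.comp_apply, LinearMap.mem_ker.1 y.2, map_zero, smul_zero]
    rwa [LinearMap.lTensor_smul, LinearMap.lTensor_id] at h4
  have hmem : (τ * σ : A) ∈ m := by
    have : (τ * σ : A) ∈ (⊥ : Submodule A _).colon {y} := by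
      rw [Submodule.mem_colon_singleton, hann]
      exact zero_mem _
    exact hy.symm.le this
  exact (m.primeCompl.mul_mem τ.2 σ.2) hmem

end

/-- Tor-independence of `N` and `M`, if locally the projective dimension of `M` is at most the
depth of `N`; moreover the depth of `N ⊗ M` is then at least the difference. -/
theorem isZero_Tor_and_depthGE_tensorProduct [IsNoetherianRing A] (N : Type u) [AddCommGroup N]
    [Module A N] [Module.Finite A N] (n : ℕ) (t : PrimeSpectrum A → ℕ)
    (hN : ∀ m : PrimeSpectrum A, DepthGE (Localization.AtPrime m.asIdeal)
      (LocalizedModule m.asIdeal.primeCompl N) (t m))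
    (M : Type u) [AddCommGroup M] [Module A M] [Module.Finite A M]
    (hM : HasProjectiveDimensionLT (ModuleCat.of A M) (n + 1)) (s : PrimeSpectrum A → ℕ)
    (hs : ∀ m : PrimeSpectrum A, HasProjectiveDimensionLT
      (ModuleCat.of (Localization.AtPrime m.asIdeal)
        (LocalizedModule m.asIdeal.primeCompl M)) (s m + 1))
    (hst : ∀ m, s m ≤ t m) :
    (∀ i : ℕ, 1 ≤ i → Limits.IsZero
      (((Tor (ModuleCat.{u} A) i).obj (ModuleCat.of A N)).obj (ModuleCat.of A M))) ∧
    ∀ m : PrimeSpectrum A, DepthGE (Localization.AtPrime m.asIdeal)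
      (LocalizedModule m.asIdeal.primeCompl (N ⊗[A] M)) (t m - s m) := by
  induction n generalizing M s with
  | zero =>
    have := ModuleCat.hasProjectiveDimensionLT_one_iff.1 hM
    have hproj : Projective (ModuleCat.of A M) := (IsProjective.iff_projective _).1 this
    refine ⟨fun i hi => ?_, fun m => ?_⟩
    · obtain ⟨i, rfl⟩ := Nat.exists_eq_add_of_le' hi
      exact isZero_Tor_succ_of_projective (ModuleCat A) (ModuleCat.of A N) (ModuleCat.of A M) i
    · have := LocalizedModule.projective m.asIdeal M
      exact (DepthGE.localized_tensorProduct m.asIdeal (hN m)).mono (Nat.sub_le _ _)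
  | succ n ih =>
    obtain ⟨r, f, hf⟩ := Module.Finite.exists_fin' A M
    have hex : Function.Exact (LinearMap.ker f).subtype f := LinearMap.exact_subtype_ker_map f
    have hinj := (LinearMap.ker f).subtype_injective
    have hP (m : PrimeSpectrum A) := LocalizedModule.projective m.asIdeal (Fin r → A)
    have hproj (m : PrimeSpectrum A) (h0 : s m = 0) :
        Module.Projective (Localization.AtPrime m.asIdeal)
          (LocalizedModule m.asIdeal.primeCompl M) := by
      have := hs m
      rw [h0] at this
      exact ModuleCat.hasProjectiveDimensionLT_one_iff.1 this
    obtain ⟨hTor, hdep⟩ := ih (LinearMap.ker f) ((hex.hasProjectiveDimensionLT_iff hinj hf n).1 hM)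
      -- Truncated subtraction is harmless: where `s m = 0` the syzygy is locally projective too.
      (fun m => s m - 1) (fun m => by
        have := hs m
        exact ((LocalizedModule.map_exact' m.asIdeal hex).hasProjectiveDimensionLT_iff
          (LocalizedModule.map_injective _ _ hinj) (LocalizedModule.map_surjective _ _ hf) _).1
          (hasProjectiveDimensionLT_of_ge _ (s m + 1) _ (by omega)))
      (fun m => by have := hst m; omega)
    have hinjN : Function.Injective ((LinearMap.ker f).subtype.lTensor N) := by
      rw [← LinearMap.ker_eq_bot]
      by_contra hne
      have := Submodule.nontrivial_iff_ne_bot.2 hne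
      obtain ⟨m, hm⟩ := associatedPrimes.nonempty A
        (LinearMap.ker ((LinearMap.ker f).subtype.lTensor N))
      have hmp : m.IsPrime := hm.isPrime
      have h1 := hdep ⟨m, hmp⟩
      have h2 := hst ⟨m, hmp⟩
      -- If `t = 0` then `s = 0` and `M` is projective at `m`; otherwise `t - (s - 1) ≥ 1`, so `m`
      -- is not associated to `N ⊗ K`.
      by_cases h0 : t ⟨m, hmp⟩ = 0
      · have := hproj ⟨m, hmp⟩ (by omega)
        exact notMem_associatedPrimes_ker_lTensor m N hex hinj hf hm
      · refine (h1.mono (s := 1) (by omega)).notMem_associatedPrimes m ?_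
        exact associatedPrimes.subset_of_injective (Submodule.subtype_injective _) hm
    refine ⟨ModuleCat.isZero_Tor_of_shortExact (ModuleCat.of A N) (hex.shortExact hinj hf)
      ((IsProjective.iff_projective (Fin r → A)).1 inferInstance) hinjN hTor, fun m => ?_⟩
    -- For `s m = 0` the bound `t - (s - 1)` on `N ⊗ K` is only `t`, one short of what the exact
    -- sequence requires.
    by_cases h0 : s m = 0
    · have := hproj m h0
      exact (DepthGE.localized_tensorProduct m.asIdeal (hN m)).mono (Nat.sub_le _ _)
    · have := hP m
      have := hst m
      exact DepthGE.of_exact_right (LocalizedModule.map_exact' m.asIdeal (lTensor_exact N hex hf))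
        (LocalizedModule.map_injective _ _ hinjN)
        (LocalizedModule.map_surjective _ _ (LinearMap.lTensor_surjective N hf))
        ((hdep m).mono (by omega))
        ((DepthGE.localized_tensorProduct m.asIdeal (hN m)).mono (Nat.sub_le _ _))

end Induction

/-! ### The theorem -/

theorem mainTheorem9 {A R : Type u} [CommRing A] [CommRing R] [Algebra A R]
    (hinj : Function.Injective (algebraMap A R)) [Module.Finite A R]
    [IsNoetherianRing A] (hnormal : IsNormalRing A)
    (hequi : IsEquidimensional R)
    (hpd : projectiveDimension (ModuleCat.of A R) ≠ ⊤)
    (hdepth : ∀ (p : Ideal R) [p.IsPrime],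
      ringKrullDim (Localization.AtPrime p) ≤
        ((2 * localDepth (Localization.AtPrime p) : ℕ∞) : WithBot ℕ∞)) :
    ∀ i : ℕ, 1 ≤ i →
      Limits.IsZero
        (((Tor (ModuleCat.{u} A) i).obj (ModuleCat.of A R)).obj (ModuleCat.of A R)) := by
  have : IsNoetherianRing R := IsNoetherianRing.of_finite A R
  have := hnormal.hasGoingDown hinj hequi
  obtain ⟨n, hn⟩ : ∃ n : ℕ, HasProjectiveDimensionLT (ModuleCat.of A R) (n + 1) := by
    obtain ⟨n, hn⟩ : ∃ n : ℕ, projectiveDimension (ModuleCat.of A R) ≤ n := by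
      generalize projectiveDimension (ModuleCat.of A R) = d at hpd
      induction d with
      | bot => exact ⟨0, bot_le⟩
      | coe d =>
        induction d with
        | top => exact absurd rfl hpd
        | coe d => exact ⟨d, le_rfl⟩
    exact ⟨n, (projectiveDimension_le_iff _ _).1 hn⟩
  have hfin (m : PrimeSpectrum A) : ∃ h : ℕ, m.asIdeal.height = h :=
    ⟨_, (ENat.natCast_toNat (Ideal.height_ne_top m.2.ne_top)).symm⟩
  choose h hh using hfin
  -- `(h m + 1) / 2` is `⌈h/2⌉`.
  have hdep (m : PrimeSpectrum A) : DepthGE (Localization.AtPrime m.asIdeal)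
      (LocalizedModule m.asIdeal.primeCompl R) ((h m + 1) / 2) := by
    refine DepthGE.of_forall_comap_eq (R := R) m.asIdeal _ R fun p _ hp => ?_
    have : p.LiesOver m.asIdeal := ⟨hp.symm⟩
    have hle : m.asIdeal.height ≤ p.height := by
      rw [Ideal.height_eq_height_add_of_liesOver_of_hasGoingDown m.asIdeal p]
      exact le_self_add
    have hd := hdepth p
    rw [IsLocalization.AtPrime.ringKrullDim_eq_height p, WithBot.coe_le_coe] at hd
    refine DepthGE.of_linearEquiv ?_ (depthGE_of_le_two_mul_localDepth (Localization.AtPrime p)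
      ((h m + 1) / 2) (h m) (by omega) (hh m ▸ hle.trans hd))
    exact ((IsLocalizedModule.iso p.primeCompl
      (Algebra.linearMap R (Localization.AtPrime p))).extendScalarsOfIsLocalization
        p.primeCompl (Localization.AtPrime p)).symm
  refine (isZero_Tor_and_depthGE_tensorProduct R n (fun m => (h m + 1) / 2) hdep R hn
    -- The bound on projective dimension is `h - ⌈h/2⌉ = ⌊h/2⌋`, at most the depth bound `⌈h/2⌉`.
    (fun m => h m - (h m + 1) / 2) (fun m => ?_) (fun m => by omega)).1
  have : Nontrivial (LocalizedModule m.asIdeal.primeCompl R) := by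
    let e := IsLocalizedModule.iso m.asIdeal.primeCompl
      (Algebra.linearMap A (Localization.AtPrime m.asIdeal))
    exact ((LocalizedModule.map_injective m.asIdeal.primeCompl (Algebra.linearMap A R) hinj).comp
      e.symm.injective).nontrivial
  obtain ⟨rs, hlen, hmem, hreg⟩ := (hdep m).exists_isRegular
  have := hasProjectiveDimensionLT_of_isWeaklyRegular (h := h m)
    (by rw [IsLocalization.AtPrime.ringKrullDim_eq_height m.asIdeal, hh m]; rfl) _
    (LocalizedModule.hasProjectiveDimensionLT m.asIdeal hn) rs hmem hreg.toIsWeaklyRegular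
  rwa [hlen] at this
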